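/- Let $K\subset\mathbb{R}^{D}$ be a non-empty compact set, let $\mathcal{P}(K)$ be the set of Borel probability measures on $K$, and let $\mathbb{P},\mathbb{Q}\in\mathcal{P}(K)$. Let $\mathcal{H}$ be a real Hilbert space and $u:K\to\mathcal{H}$ a map such that the kernel $k(y,y')=\langle u(y),u(y')\rangle_{\mathcal{H}}$ is continuous on $K\times K$. Let $\gamma\in[0,1]$ and, for $x\in K$, $\mu\in\mathcal{P}(K)$, put $$C(x,\mu)=\tfrac12 k(x,x)+\tfrac{1-\gamma}{2}\int_K k(y,y)\,d\mu(y)-\int_K k(x,y)\,d\mu(y)+\tfrac{\gamma}{2}\int_{K\times K}k(y,y')\,d\mu(y)\,d\mu(y').$$ Let $\Pi(\mathbb{P},\mathbb{Q})$ be the set of probability measures on $K\times K$ with marginals $\mathbb{P}$ and $\mathbb{Q}$, let $\pi(\cdot|x)$ denote the conditional distribution of the second coordinate given the first, and let $$\mathrm{Cost}(\mathbb{P},\mathbb{Q})=\inf_{\pi\in\Pi(\mathbb{P},\mathbb{Q})}\int_K C\big(x,\pi(\cdot|x)\big)\,d\mathbb{P}(x).$$ Let $\mathcal{Z}$ be a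 Polish space and $\mathbb{S}$ an atomless Borel probability measure on $\mathcal{Z}$. Then all the integrals and infima over $\pi$, $\mu$, $T$ below and above are well defined and finite, and: 1. the infimum defining $\mathrm{Cost}(\mathbb{P},\mathbb{Q})$ is attained by some $\pi^{*}\in\Pi(\mathbb{P},\mathbb{Q})$; 2. $\displaystyle \mathrm{Cost}(\mathbb{P},\mathbb{Q})=\sup_{f}\Big[\int_K f^{C}(x)\,d\mathbb{P}(x)+\int_K f(y)\,d\mathbb{Q}(y)\Big]$, where $f^{C}(x)=\inf_{\mu\in\mathcal{P}(K)}\big\{C(x,\mu)-\int_K f\,d\mu\big\}$; 3. $\displaystyle \mathrm{Cost}(\mathbb{P},\mathbb{Q})=\sup_{f}\inf_{T}\Big[\int_K\Big(C\big(x,T_x\sharp\mathbb{S}\big)-\int_{\mathcal{Z}}f\big(T_x(z)\big)\,d\mathbb{S}(z)\Big)d\mathbb{P}(x)+\int_K f(y)\,d\mathbb{Q}(y)\Big]$, where the infimum is over all measurable maps $T:K\times\mathcal{Z}\to K$, $T_x=T(x,\cdot)$, and $T_x\sharp\mathbb{S}$ is the push-forward of $\mathbb{S}$ under $T_x$. In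 2 and 3 the supremum is over all continuous functions $f:K\to\mathbb{R}$. -/

import Mathlib

open MeasureTheory ProbabilityTheory

noncomputable section

namespace WeakOT

/-- The conditional distribution `π(· | x)` of a distribution `π` on `X × Y`. -/
def condDistr {X Y : Type*} [MeasurableSpace X] [MeasurableSpace Y] [StandardBorelSpace Y]
    [Nonempty Y] (π : ProbabilityMeasure (X × Y)) (x : X) : ProbabilityMeasure Y :=
  ⟨(π : Measure (X × Y)).condKernel x, inferInstance⟩

/-- The set `Π(P, Q)` of transport plans: distributions on `X × Y` with marginals `P` and `Q`. -/
def plans {X Y : Type*} [MeasurableSpace X] [MeasurableSpace Y]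
    (P : ProbabilityMeasure X) (Q : ProbabilityMeasure Y) : Set (ProbabilityMeasure (X × Y)) :=
  {π | (π : Measure (X × Y)).fst = (P : Measure X) ∧ (π : Measure (X × Y)).snd = (Q : Measure Y)}

/-- The weak transport functional `π ↦ ∫ C(x, π(· | x)) dπ(x)`, where `dπ(x)` is the first
marginal of `π`. -/
def planCost {X Y : Type*} [MeasurableSpace X] [MeasurableSpace Y] [StandardBorelSpace Y]
    [Nonempty Y] (C : X → ProbabilityMeasure Y → ℝ) (π : ProbabilityMeasure (X × Y)) : ℝ :=
  ∫ x, C x (condDistr π x) ∂(π : Measure (X × Y)).fst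

/-- The weak optimal transport cost between `P` and `Q`. -/
def otCost {X Y : Type*} [MeasurableSpace X] [MeasurableSpace Y] [StandardBorelSpace Y]
    [Nonempty Y] (C : X → ProbabilityMeasure Y → ℝ)
    (P : ProbabilityMeasure X) (Q : ProbabilityMeasure Y) : ℝ :=
  sInf (planCost C '' plans P Q)

/-- `π` is an optimal transport plan between `P` and `Q`: it minimizes the weak transport
functional over `Π(P, Q)`. -/
def IsOTPlan {X Y : Type*} [MeasurableSpace X] [MeasurableSpace Y] [StandardBorelSpace Y]
    [Nonempty Y] (C : X → ProbabilityMeasure Y → ℝ)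
    (P : ProbabilityMeasure X) (Q : ProbabilityMeasure Y)
    (π : ProbabilityMeasure (X × Y)) : Prop :=
  π ∈ plans P Q ∧ ∀ π' ∈ plans P Q, planCost C π ≤ planCost C π'

/-- The weak `C`-transform `f^C(x) = inf_μ (C(x, μ) - ∫ f dμ)`, over all distributions `μ`. -/
def cTransform {X Y : Type*} [MeasurableSpace Y] (C : X → ProbabilityMeasure Y → ℝ)
    (f : Y → ℝ) (x : X) : ℝ :=
  ⨅ μ : ProbabilityMeasure Y, (C x μ - ∫ y, f y ∂(μ : Measure Y))

/-- The dual functional `∫ f^C dP + ∫ f dQ`. -/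
def dualValue {X Y : Type*} [MeasurableSpace X] [MeasurableSpace Y]
    (C : X → ProbabilityMeasure Y → ℝ) (P : ProbabilityMeasure X) (Q : ProbabilityMeasure Y)
    (f : Y → ℝ) : ℝ :=
  ∫ x, cTransform C f x ∂(P : Measure X) + ∫ y, f y ∂(Q : Measure Y)

/-- Measurable maps `T : X × Z → Y`; `T_x` is the map `z ↦ T (x, z)`. -/
abbrev StochMap (X Z Y : Type*) [MeasurableSpace X] [MeasurableSpace Z] [MeasurableSpace Y] :
    Type _ :=
  {T : X × Z → Y // Measurable T}

/-- The push-forward `T_x ♯ S`. -/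
def pushAt {X Z Y : Type*} [MeasurableSpace X] [MeasurableSpace Z] [MeasurableSpace Y]
    (S : ProbabilityMeasure Z) (T : StochMap X Z Y) (x : X) : ProbabilityMeasure Y :=
  S.map (f := fun z => T.1 (x, z)) (T.2.comp measurable_prodMk_left).aemeasurable

/-- The function of `x` integrated in the saddle-point functional:
`C(x, T_x ♯ S) - ∫ f(T_x(z)) dS(z)`. -/
def saddleIntegrand {X Z Y : Type*} [MeasurableSpace X] [MeasurableSpace Z] [MeasurableSpace Y]
    (C : X → ProbabilityMeasure Y → ℝ) (S : ProbabilityMeasure Z)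
    (f : Y → ℝ) (T : StochMap X Z Y) (x : X) : ℝ :=
  C x (pushAt S T x) - ∫ z, f (T.1 (x, z)) ∂(S : Measure Z)

/-- The saddle-point functional `L(f, T)`. -/
def saddle {X Z Y : Type*} [MeasurableSpace X] [MeasurableSpace Z] [MeasurableSpace Y]
    (C : X → ProbabilityMeasure Y → ℝ) (P : ProbabilityMeasure X) (Q : ProbabilityMeasure Y)
    (S : ProbabilityMeasure Z) (f : Y → ℝ) (T : StochMap X Z Y) : ℝ :=
  ∫ x, saddleIntegrand C S f T x ∂(P : Measure X) + ∫ y, f y ∂(Q : Measure Y)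

/-- The PDS kernel `k(y, y') = ⟨u(y), u(y')⟩` with feature map `u`. -/
def pdsKernel {Y H : Type*} [NormedAddCommGroup H] [InnerProductSpace ℝ H] (u : Y → H)
    (y y' : Y) : ℝ :=
  inner ℝ (u y) (u y')

/-- The `γ`-weak kernel cost `C_{k,γ}(x, μ)`. -/
def kernelCost {Y : Type*} [MeasurableSpace Y] (k : Y → Y → ℝ) (γ : ℝ)
    (x : Y) (μ : ProbabilityMeasure Y) : ℝ :=
  1 / 2 * k x x + (1 - γ) / 2 * ∫ y, k y y ∂(μ : Measure Y) - ∫ y, k x y ∂(μ : Measure Y)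
    + γ / 2 * ∫ p, k p.1 p.2 ∂((μ : Measure Y).prod (μ : Measure Y))

end WeakOT

end

/-!
Write `m(μ) = ∫ u dμ` for the mean embedding. The cost is
`C(x, μ) = ½‖u x‖² + (1 - γ)/2 ∫ ‖u‖² dμ - ⟨u x, m(μ)⟩ + γ/2 ‖m(μ)‖²`, and `‖m‖²` is the supremum
over `h` of `2⟨h, m⟩ - ‖h‖²`. Hence every continuous `φ : K → H` gives a classical cost
`c_φ(x, y)`, continuous on `K × K` and concave in `φ`, such that
`∫ c_φ dπ = ∫ C(x, π(·|x)) dP(x) - γ/2 ∫ ‖φ x - m(π(·|x))‖² dP(x)` (`integral_tangentCost_add`).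
As continuous maps are dense in `L²(P; H)`, the weak transport functional is the supremum of the
functionals `π ↦ ∫ c_φ dπ` (`exists_lt_integral_tangentCost`). These are affine and weakly
continuous, so the functional is lower semicontinuous, and it attains its minimum on the weakly
compact set of plans.

For the duality, consider the Lagrangian `∫ c_φ dπ - ∫ f dπ₂ + ∫ f dQ` for `π` in the compact set of
plans with first marginal `P` and `(φ, f)` in the space of pairs of continuous functions. It is
affine and continuous in `π` and concave in `(φ, f)`. If `t < Cost(P, Q)`, every such `π` has a pair
`(φ, f)` making the Lagrangian larger than `t` (`exists_lt_lagrangian`); the minimax principle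
`exists_forall_lt_of_concave` then gives one pair that works for all `π`.

This bound is transferred to the weak transform through the stochastic maps. A map `T` gives the
plan `planOf P S T` with first marginal `P` and conditional distributions `T_x♯S`, so the
saddle-point functional at `T` is at least the Lagrangian at that plan. Since an atomless `S` pushes
forward to every distribution on `K` and the weak transform is continuous, almost minimizers can be
selected measurably and realized by a stochastic map; so the infimum of the saddle-point functional
over `T` is exactly `∫ f^C dP + ∫ f dQ` (`iInf_saddle_eq_dualValue`). Both dual formulas follow.
-/

open MeasureTheory ProbabilityTheory

noncomputable section

namespace WeakOT

open Set Filter Topology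

/-! ### A minimax principle -/

/-- A one-sided minimax principle: on a compact space, if for every `x` some `v` makes `Λ x v`
larger than `t`, then a single `v` does so for all `x`. The function `Λ` is continuous in `x` and
concave in `v`, and the hypothesis `hmix` says that it is affine in `x` for a convex structure on
`X` that need not come from a vector space. -/
theorem exists_forall_lt_of_concave {X V : Type*} [TopologicalSpace X] [CompactSpace X]
    [AddCommGroup V] [Module ℝ V] {Λ : X → V → ℝ} (hcont : ∀ v, Continuous fun x => Λ x v)
    (hconc : ∀ x, ConcaveOn ℝ univ (Λ x))
    (hmix : ∀ x y : X, ∀ a b : ℝ, 0 ≤ a → 0 ≤ b → a + b = 1 →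
      ∃ z, ∀ v, Λ z v = a * Λ x v + b * Λ y v)
    {t : ℝ} (h : ∀ x, ∃ v, t < Λ x v) : ∃ v, ∀ x, t < Λ x v := by
  classical
  rcases isEmpty_or_nonempty X with hX | ⟨⟨x₀⟩⟩
  · exact ⟨0, fun x => (hX.false x).elim⟩
  obtain ⟨s, hs⟩ := isCompact_univ.elim_finite_subcover (fun v => {x | t < Λ x v})
    (fun v => isOpen_lt continuous_const (hcont v)) (fun x _ => by simpa using h x)
  -- The image of `X` in `ℝ^s` is compact and convex and misses the orthant below `(t, …, t)`;
  -- a separating functional has nonnegative coefficients, and these give the convex combination.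
  let F : X → (s → ℝ) := fun x i => Λ x i
  have hF : Continuous F := continuous_pi fun i => hcont i
  have hFconv : Convex ℝ (range F) := by
    rintro _ ⟨x, rfl⟩ _ ⟨y, rfl⟩ a b ha hb hab
    obtain ⟨z, hz⟩ := hmix x y a b ha hb hab
    exact ⟨z, funext fun i => by simp [F, hz]⟩
  have hdisj : Disjoint (Iic fun _ : s => t) (range F) := by
    rw [Set.disjoint_left]
    rintro _ hw ⟨x, rfl⟩
    obtain ⟨v, hv, hx⟩ : ∃ v ∈ s, t < Λ x v := by simpa using hs (mem_univ x)
    exact absurd (hw ⟨v, hv⟩) (not_le.2 hx)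
  obtain ⟨l, p, q, hlp, hpq, hlq⟩ := geometric_hahn_banach_closed_compact (convex_Iic _)
    isClosed_Iic hFconv (isCompact_range hF) hdisj
  let c : s → ℝ := fun i => l fun j => if i = j then 1 else 0
  have hl : ∀ w : s → ℝ, l w = ∑ i, w i * c i := fun w =>
    LinearMap.pi_apply_eq_sum_univ l.toLinearMap w
  have hc : ∀ i, 0 ≤ c i := by
    intro i
    by_contra! hi
    -- the orthant is unbounded in the direction `-e_i`, along which `l` would exceed `p`
    have hlt : l (fun _ => t) < p := hlp _ (mem_Iic.2 le_rfl)
    have := hlp ((fun _ => t) - ((p - l fun _ => t) / (-c i)) • fun j => if i = j then 1 else 0) (by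
      intro j
      have h0 : 0 ≤ (p - l fun _ => t) / (-c i) := div_nonneg (by linarith) (by linarith)
      by_cases hij : i = j <;> simp [hij] ; simpa [hij] using h0)
    rw [map_sub, map_smul] at this
    change _ - (p - l fun _ => t) / (-c i) * c i < p at this
    rw [div_neg, neg_mul, div_mul_cancel₀ _ hi.ne] at this
    linarith
  have ht : t * ∑ i, c i < p := by
    have := hlp _ (mem_Iic.2 le_rfl)
    rwa [hl, ← Finset.mul_sum] at this
  have hFx : ∀ x, p < ∑ i : s, Λ x i * c i := fun x => by
    have := hlq (F x) ⟨x, rfl⟩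
    rw [hl] at this
    exact hpq.trans this
  -- if all `c i` vanished, the image point `F x₀` would not be separated from the orthant
  have hpos : 0 < ∑ i, c i := by
    refine (Finset.sum_nonneg fun i _ => hc i).lt_of_ne' fun h0 => ?_
    have hz : ∀ i, c i = 0 := fun i =>
      (Finset.sum_eq_zero_iff_of_nonneg fun i _ => hc i).1 h0 i (Finset.mem_univ i)
    have h1 := hFx x₀
    simp only [hz, mul_zero, Finset.sum_const_zero] at h1 ht
    linarith
  refine ⟨∑ i, (c i / ∑ j, c j) • (i : V), fun x => ?_⟩
  refine lt_of_lt_of_le ?_ ((hconc x).le_map_sum (t := Finset.univ)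
    (fun i _ => div_nonneg (hc i) hpos.le) (by rw [← Finset.sum_div, div_self hpos.ne'])
    (fun _ _ => mem_univ _))
  have : ∑ i : s, (c i / ∑ j, c j) • Λ x i = (∑ i : s, Λ x i * c i) / ∑ j, c j := by
    rw [Finset.sum_div]
    exact Finset.sum_congr rfl fun i _ => by rw [smul_eq_mul]; ring
  rw [this, lt_div_iff₀ hpos]
  exact ht.trans (hFx x)

/-! ### Atomless measures push forward to every measure -/

/-- The distribution function of an atomless law on the unit interval pushes it to the uniform
law. -/
theorem exists_measurable_map_eq_volume_unitInterval (ν : Measure unitInterval)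
    [IsProbabilityMeasure ν] [NullSingletonClass ν] :
    ∃ F : unitInterval → unitInterval, Measurable F ∧ ν.map F = volume := by
  let F : unitInterval → unitInterval := fun x => ⟨ν.real (Iic x), measureReal_nonneg,
    measureReal_le_one⟩
  have hmono : Monotone F := fun x y hxy => measureReal_mono (Iic_subset_Iic.2 hxy)
  have hcont : Continuous F := by
    refine Continuous.subtype_mk ?_ _
    have heq : (fun x => ν.real (Iic x)) =
        fun x => ∫ a, (Iic x).indicator (fun _ => (1 : ℝ)) a ∂ν := by
      ext x
      rw [integral_indicator measurableSet_Iic]; simp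
    rw [heq, continuous_iff_continuousAt]
    intro x
    refine continuousAt_of_dominated (bound := fun _ => 1)
      (.of_forall fun y => (measurable_const.indicator measurableSet_Iic).aestronglyMeasurable)
      (.of_forall fun y => .of_forall fun a => ?_) (integrable_const _) ?_
    · by_cases h : a ∈ Iic y <;> simp [h]
    · have hx : ∀ᵐ a ∂ν, a ≠ x := by simp [ae_iff]
      filter_upwards [hx] with a ha
      -- away from `a`, the function `y ↦ 1_{a ≤ y}` is locally constant
      rcases lt_or_gt_of_ne ha with h | h
      · refine (continuousAt_const (y := (1 : ℝ))).congr ?_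
        filter_upwards [lt_mem_nhds h] with y hy
        simp [hy.le]
      · refine (continuousAt_const (y := (0 : ℝ))).congr ?_
        filter_upwards [gt_mem_nhds h] with y hy
        simp [hy]
  have h0 : F 0 = 0 := by
    ext
    have : Iic (0 : unitInterval) = {0} := by ext x; simp
    simp [F, this, measureReal_def]
  have h1 : F 1 = 1 := by
    ext
    have : Iic (1 : unitInterval) = univ := by ext x; simp [unitInterval.le_one']
    simp [F, this]
  refine ⟨F, hmono.measurable, Measure.ext_of_Iic _ _ fun t => ?_⟩
  rw [Measure.map_apply hmono.measurable measurableSet_Iic, unitInterval.volume_Iic]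
  -- `{F ≤ t} = [0, x]` for its largest element `x`, and `F x = t` by the intermediate value theorem
  obtain ⟨x, hx, hmax⟩ := (isClosed_Iic.preimage hcont : IsClosed (F ⁻¹' Iic t)).isCompact
    |>.exists_isGreatest ⟨0, by simp [h0]⟩
  have hpre : F ⁻¹' Iic t = Iic x :=
    Subset.antisymm (fun y hy => hmax hy) fun y hy => (hmono hy).trans hx
  have hFx : F x = t := by
    refine le_antisymm hx ?_
    obtain ⟨y, hy⟩ : t ∈ range F := mem_range_of_exists_le_of_exists_ge hcont
      ⟨0, by simp [h0]⟩ ⟨1, by rw [h1]; exact unitInterval.le_one'⟩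
    exact hy.ge.trans (hmono (hmax hy.le))
  rw [hpre, ← hFx]
  simp [F]

/-- An atomless law on a standard Borel space pushes forward to every law on a standard Borel
space. -/
theorem exists_measurable_map_eq_of_atomless {Z Y : Type*} [MeasurableSpace Z]
    [StandardBorelSpace Z] [MeasurableSpace Y] [StandardBorelSpace Y] [Nonempty Y]
    (S : Measure Z) [IsProbabilityMeasure S] [NullSingletonClass S] (μ : Measure Y)
    [IsProbabilityMeasure μ] :
    ∃ g : Z → Y, Measurable g ∧ S.map g = μ := by
  have hg := measurableEmbedding_sigmoid_comp_embeddingReal Z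
  set g := unitInterval.sigmoid ∘ embeddingReal Z
  have : IsProbabilityMeasure (S.map g) :=
    Measure.isProbabilityMeasure_map hg.measurable.aemeasurable
  have : NullSingletonClass (S.map g) := ⟨fun x => by
    rw [hg.map_apply]
    exact (subsingleton_singleton.preimage hg.injective).measure_zero S⟩
  obtain ⟨F, hF, hFmap⟩ := exists_measurable_map_eq_volume_unitInterval (S.map g)
  obtain ⟨G, hG, hGmap⟩ := μ.exists_measurable_map_eq
  refine ⟨G ∘ F ∘ g, hG.comp (hF.comp hg.measurable), ?_⟩
  rw [← Measure.map_map hG (hF.comp hg.measurable), ← Measure.map_map hF hg.measurable, hFmap,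
    hGmap]

/-! ### The kernel cost in terms of the mean embedding -/

theorem _root_.Continuous.integrable_of_compactSpace {X E : Type*} [TopologicalSpace X]
    [CompactSpace X] [MeasurableSpace X] [OpensMeasurableSpace X] [NormedAddCommGroup E]
    {μ : Measure X} [IsFiniteMeasure μ] {f : X → E} (hf : Continuous f) : Integrable f μ :=
  hf.integrable_of_hasCompactSupport (HasCompactSupport.of_compactSpace f)

/-- A feature map with continuous kernel is continuous:
`‖u y - u y'‖² = k(y, y) - 2 k(y, y') + k(y', y')`. -/
theorem continuous_of_continuous_pdsKernel {Y H : Type*} [TopologicalSpace Y]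
    [NormedAddCommGroup H] [InnerProductSpace ℝ H] {u : Y → H}
    (hk : Continuous fun p : Y × Y => pdsKernel u p.1 p.2) : Continuous u := by
  rw [continuous_iff_continuousAt]
  intro y₀
  rw [ContinuousAt, tendsto_iff_norm_sub_tendsto_zero]
  have h : Tendsto (fun y => ‖u y - u y₀‖ ^ 2) (𝓝 y₀) (𝓝 0) := by
    have hc : Continuous fun y => pdsKernel u y y - 2 * pdsKernel u y y₀ + pdsKernel u y₀ y₀ :=
      ((hk.comp (continuous_id.prodMk continuous_id)).sub
        (continuous_const.mul (hk.comp (continuous_id.prodMk continuous_const)))).add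
        continuous_const
    have h2 := hc.tendsto y₀
    rw [show pdsKernel u y₀ y₀ - 2 * pdsKernel u y₀ y₀ + pdsKernel u y₀ y₀ = 0 by ring] at h2
    refine h2.congr fun y => ?_
    rw [norm_sub_sq_real, pdsKernel, pdsKernel, pdsKernel, real_inner_self_eq_norm_sq,
      real_inner_self_eq_norm_sq]
  simpa using h.sqrt

theorem exists_forall_norm_le {K H : Type*} [TopologicalSpace K] [CompactSpace K]
    [NormedAddCommGroup H] {u : K → H} (hu : Continuous u) : ∃ B, 0 ≤ B ∧ ∀ y, ‖u y‖ ≤ B := by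
  obtain ⟨B, hB⟩ := (isCompact_range hu).isBounded.exists_norm_le
  exact ⟨max B 0, le_max_right _ _, fun y => (hB _ ⟨y, rfl⟩).trans (le_max_left _ _)⟩

/-- The classical cost `c_φ(x, y)`, for which `μ ↦ ∫ c_φ(x, y) dμ(y)` is the affine minorant of
`μ ↦ C(x, μ)` tangent at mean embedding `φ x`. -/
def tangentCost {K H : Type*} [NormedAddCommGroup H] [InnerProductSpace ℝ H]
    (u : K → H) (γ : ℝ) (φ : K → H) (p : K × K) : ℝ :=
  1 / 2 * ‖u p.1‖ ^ 2 + (1 - γ) / 2 * ‖u p.2‖ ^ 2 - inner ℝ (u p.1) (u p.2)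
    + γ / 2 * (2 * inner ℝ (φ p.1) (u p.2) - ‖φ p.1‖ ^ 2)

theorem continuous_tangentCost {K H : Type*} [TopologicalSpace K]
    [NormedAddCommGroup H] [InnerProductSpace ℝ H] {u : K → H} (hu : Continuous u)
    (γ : ℝ) {φ : K → H} (hφ : Continuous φ) : Continuous (tangentCost u γ φ) := by
  unfold tangentCost; fun_prop

theorem concaveOn_tangentCost {K H : Type*} [TopologicalSpace K]
    [NormedAddCommGroup H] [InnerProductSpace ℝ H] (u : K → H) {γ : ℝ} (hγ : 0 ≤ γ) (p : K × K) :
    ConcaveOn ℝ univ fun φ : C(K, H) => tangentCost u γ φ p := by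
  refine ⟨convex_univ, fun φ _ ψ _ a b ha hb hab => ?_⟩
  have h := ((convexOn_univ_norm (E := H)).pow (fun _ _ => norm_nonneg _) 2).2
    (mem_univ (φ p.1)) (mem_univ (ψ p.1)) ha hb hab
  simp only [Pi.pow_apply, smul_eq_mul] at h
  simp only [tangentCost, ContinuousMap.add_apply, ContinuousMap.smul_apply, inner_add_left,
    real_inner_smul_left, smul_eq_mul]
  obtain rfl : b = 1 - a := by linarith
  nlinarith [mul_le_mul_of_nonneg_left h hγ]

/-- The mean embedding `∫ u dμ` of a distribution in the feature space. -/
def meanEmbedding {K H : Type*} [MeasurableSpace K] [NormedAddCommGroup H] [InnerProductSpace ℝ H]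
    (u : K → H) (μ : ProbabilityMeasure K) : H := ∫ y, u y ∂(μ : Measure K)

theorem norm_meanEmbedding_le {K H : Type*} [MeasurableSpace K] [NormedAddCommGroup H]
    [InnerProductSpace ℝ H] {u : K → H} {B : ℝ} (hB : ∀ y, ‖u y‖ ≤ B)
    (μ : ProbabilityMeasure K) : ‖meanEmbedding u μ‖ ≤ B := by
  simpa [meanEmbedding] using
    norm_integral_le_of_norm_le_const (μ := (μ : Measure K)) (.of_forall hB)

theorem stronglyMeasurable_meanEmbedding {K H : Type*} [MetricSpace K] [CompactSpace K]
    [MeasurableSpace K] [BorelSpace K] [NormedAddCommGroup H] [InnerProductSpace ℝ H]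
    {u : K → H} (hu : Continuous u) {κ : K → ProbabilityMeasure K}
    (hκ : Measurable fun x => (κ x : Measure K)) :
    StronglyMeasurable fun x => meanEmbedding u (κ x) :=
  let η : Kernel K K := ⟨fun x => (κ x : Measure K), hκ⟩
  have : IsMarkovKernel η := ⟨fun x => (κ x).2⟩
  StronglyMeasurable.integral_kernel_prod_right' (κ := η) (f := fun p => u p.2)
      (hu.comp continuous_snd).stronglyMeasurable

section KernelCost

variable {K H : Type*} [MetricSpace K] [CompactSpace K] [MeasurableSpace K] [BorelSpace K]
  [NormedAddCommGroup H] [InnerProductSpace ℝ H] [CompleteSpace H]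

theorem kernelCost_eq {u : K → H} (hu : Continuous u) (γ : ℝ) (x : K) (μ : ProbabilityMeasure K) :
    kernelCost (pdsKernel u) γ x μ = 1 / 2 * ‖u x‖ ^ 2
      + (1 - γ) / 2 * ∫ y, ‖u y‖ ^ 2 ∂(μ : Measure K) - inner ℝ (u x) (meanEmbedding u μ)
      + γ / 2 * ‖meanEmbedding u μ‖ ^ 2 := by
  have hint : Integrable u (μ : Measure K) := hu.integrable_of_compactSpace
  have hprod : ∫ p, pdsKernel u p.1 p.2 ∂((μ : Measure K).prod (μ : Measure K))
      = ‖meanEmbedding u μ‖ ^ 2 := by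
    rw [integral_prod _ (Continuous.integrable_of_compactSpace (by unfold pdsKernel; fun_prop))]
    simp only [pdsKernel, integral_inner hint]
    rw [← real_inner_self_eq_norm_sq]
    simp_rw [real_inner_comm (∫ y, u y ∂(μ : Measure K))]
    exact integral_inner hint _
  unfold kernelCost
  rw [hprod]
  simp only [pdsKernel, real_inner_self_eq_norm_sq, integral_inner hint]
  rfl

/-- Completing the square shows that the tangent cost lies below the kernel cost, by a gap that
vanishes when `φ x` is the mean embedding of `μ`. -/
theorem integral_tangentCost {u : K → H} (hu : Continuous u) (γ : ℝ) (φ : K → H) (x : K)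
    (μ : ProbabilityMeasure K) :
    ∫ y, tangentCost u γ φ (x, y) ∂(μ : Measure K)
      = kernelCost (pdsKernel u) γ x μ - γ / 2 * ‖φ x - meanEmbedding u μ‖ ^ 2 := by
  have hint : Integrable u (μ : Measure K) := hu.integrable_of_compactSpace
  have h2 : Integrable (fun y => ‖u y‖ ^ 2) (μ : Measure K) :=
    (hu.norm.pow 2).integrable_of_compactSpace
  have h3 : ∀ c : H, Integrable (fun y => (inner ℝ c (u y) : ℝ)) (μ : Measure K) := fun c =>
    hint.const_inner c
  have heq : (fun y => tangentCost u γ φ (x, y)) = fun y =>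
      (1 / 2 * ‖u x‖ ^ 2 - γ / 2 * ‖φ x‖ ^ 2) + (1 - γ) / 2 * ‖u y‖ ^ 2
        + inner ℝ (γ • φ x - u x) (u y) := by
    ext y
    simp only [tangentCost, inner_sub_left, real_inner_smul_left]
    ring
  have h4 : Integrable (fun y => (1 / 2 * ‖u x‖ ^ 2 - γ / 2 * ‖φ x‖ ^ 2)
      + (1 - γ) / 2 * ‖u y‖ ^ 2) (μ : Measure K) := (integrable_const _).add (h2.const_mul _)
  rw [heq, integral_add h4 (h3 _), integral_add (integrable_const _) (h2.const_mul _),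
    integral_const_mul, integral_inner hint, kernelCost_eq hu, norm_sub_sq_real, inner_sub_left,
    real_inner_smul_left]
  simp only [integral_const, probReal_univ, one_smul, meanEmbedding]
  ring

theorem exists_forall_abs_kernelCost_le {u : K → H} (hu : Continuous u) (γ : ℝ) :
    ∃ M, ∀ x μ, |kernelCost (pdsKernel u) γ x μ| ≤ M := by
  obtain ⟨B, hB0, hB⟩ := exists_forall_norm_le hu
  refine ⟨1 / 2 * B ^ 2 + |(1 - γ) / 2| * B ^ 2 + B * B + |γ / 2| * B ^ 2, fun x μ => ?_⟩
  have hsq : ∀ h : H, ‖h‖ ≤ B → ‖h‖ ^ 2 ≤ B ^ 2 := fun h hh =>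
    pow_le_pow_left₀ (norm_nonneg _) hh 2
  have h2 : |∫ y, ‖u y‖ ^ 2 ∂(μ : Measure K)| ≤ B ^ 2 := by
    have := norm_integral_le_of_norm_le_const (μ := (μ : Measure K)) (f := fun y => ‖u y‖ ^ 2)
      (C := B ^ 2) (.of_forall fun y => by simpa using hsq _ (hB y))
    simpa using this
  have hm := norm_meanEmbedding_le hB μ
  rw [kernelCost_eq hu]
  refine (abs_add_le _ _).trans (add_le_add ((abs_sub _ _).trans (add_le_add
    ((abs_add_le _ _).trans (add_le_add ?_ ?_)) ?_)) ?_)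
  · rw [abs_of_nonneg (by positivity)]
    linarith [hsq _ (hB x)]
  · rw [abs_mul]; gcongr
  · exact (abs_real_inner_le_norm _ _).trans (mul_le_mul (hB x) hm (norm_nonneg _) hB0)
  · rw [abs_mul, abs_of_nonneg (sq_nonneg ‖_‖)]
    gcongr

theorem measurable_kernelCost {u : K → H} (hu : Continuous u) (γ : ℝ)
    {κ : K → ProbabilityMeasure K} (hκ : Measurable fun x => (κ x : Measure K)) :
    Measurable fun x => kernelCost (pdsKernel u) γ x (κ x) := by
  let η : Kernel K K := ⟨fun x => (κ x : Measure K), hκ⟩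
  have : IsMarkovKernel η := ⟨fun x => (κ x).2⟩
  have h1 := stronglyMeasurable_meanEmbedding hu hκ
  have h2 : StronglyMeasurable fun x => ∫ y, ‖u y‖ ^ 2 ∂(κ x : Measure K) :=
    StronglyMeasurable.integral_kernel_prod_right' (κ := η) (f := fun p => ‖u p.2‖ ^ 2)
      ((hu.norm.pow 2).comp continuous_snd).stronglyMeasurable
  simp only [kernelCost_eq hu]
  exact (((((hu.norm.pow 2).measurable.const_mul _).add (h2.measurable.const_mul _)).sub
    (hu.stronglyMeasurable.inner h1).measurable).add ((h1.norm.measurable.pow_const 2).const_mul _))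

theorem integrable_kernelCost {u : K → H} (hu : Continuous u) (γ : ℝ)
    {κ : K → ProbabilityMeasure K} (hκ : Measurable fun x => (κ x : Measure K))
    (P : Measure K) [IsFiniteMeasure P] :
    Integrable (fun x => kernelCost (pdsKernel u) γ x (κ x)) P := by
  obtain ⟨M, hM⟩ := exists_forall_abs_kernelCost_le hu γ
  exact .of_bound (measurable_kernelCost hu γ hκ).aestronglyMeasurable M
    (.of_forall fun x => hM x _)

end KernelCost

/-! ### Semicontinuity of the transport functional and existence of optimal plans -/

theorem continuous_integral_of_compactSpace {X : Type*} [TopologicalSpace X] [CompactSpace X]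
    [MeasurableSpace X] [OpensMeasurableSpace X] {f : X → ℝ} (hf : Continuous f) :
    Continuous fun μ : ProbabilityMeasure X => ∫ x, f x ∂(μ : Measure X) :=
  ProbabilityMeasure.continuous_integral_boundedContinuousFunction
    (BoundedContinuousFunction.mkOfCompact ⟨f, hf⟩)

theorem isClosed_setOf_fst_eq {X Y : Type*} [TopologicalSpace X] [TopologicalSpace Y]
    [SecondCountableTopologyEither X Y] [MeasurableSpace X] [MeasurableSpace Y] [BorelSpace X]
    [BorelSpace Y] [HasOuterApproxClosed X] (P : ProbabilityMeasure X) :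
    IsClosed {π : ProbabilityMeasure (X × Y) | (π : Measure (X × Y)).fst = (P : Measure X)} := by
  have : {π : ProbabilityMeasure (X × Y) | (π : Measure (X × Y)).fst = (P : Measure X)} =
      {π | π.map (f := Prod.fst) measurable_fst.aemeasurable = P} := by
    ext π; exact (Subtype.ext_iff (a1 := π.map (f := Prod.fst) _)).symm
  rw [this]
  exact isClosed_eq (ProbabilityMeasure.continuous_map continuous_fst) continuous_const

theorem isClosed_setOf_snd_eq {X Y : Type*} [TopologicalSpace X] [TopologicalSpace Y]
    [SecondCountableTopologyEither X Y] [MeasurableSpace X] [MeasurableSpace Y] [BorelSpace X]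
    [BorelSpace Y] [HasOuterApproxClosed Y] (Q : ProbabilityMeasure Y) :
    IsClosed {π : ProbabilityMeasure (X × Y) | (π : Measure (X × Y)).snd = (Q : Measure Y)} := by
  have : {π : ProbabilityMeasure (X × Y) | (π : Measure (X × Y)).snd = (Q : Measure Y)} =
      {π | π.map (f := Prod.snd) measurable_snd.aemeasurable = Q} := by
    ext π; exact (Subtype.ext_iff (a1 := π.map (f := Prod.snd) _)).symm
  rw [this]
  exact isClosed_eq (ProbabilityMeasure.continuous_map continuous_snd) continuous_const

theorem nonempty_plans {X Y : Type*} [MeasurableSpace X] [MeasurableSpace Y]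
    (P : ProbabilityMeasure X) (Q : ProbabilityMeasure Y) : (plans P Q).Nonempty :=
  ⟨P.prod Q, by simp [ProbabilityMeasure.prod, Measure.fst_prod],
    by simp [ProbabilityMeasure.prod, Measure.snd_prod]⟩

section Plans

variable {K H : Type*} [MetricSpace K] [CompactSpace K] [MeasurableSpace K] [BorelSpace K]
  [Nonempty K] [NormedAddCommGroup H] [InnerProductSpace ℝ H] [CompleteSpace H]

theorem measurable_condDistr (π : ProbabilityMeasure (K × K)) :
    Measurable fun x => (condDistr π x : Measure K) :=
  ((π : Measure (K × K)).condKernel).measurable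

/-- The tangent costs minorize the transport functional, with an explicit gap. -/
theorem integral_tangentCost_add {u : K → H} (hu : Continuous u) (γ : ℝ) (φ : C(K, H))
    (π : ProbabilityMeasure (K × K)) :
    ∫ p, tangentCost u γ φ p ∂(π : Measure (K × K))
      + γ / 2 * ∫ x, ‖φ x - meanEmbedding u (condDistr π x)‖ ^ 2 ∂(π : Measure (K × K)).fst
      = planCost (kernelCost (pdsKernel u) γ) π := by
  have hsm := stronglyMeasurable_meanEmbedding hu (measurable_condDistr π)
  obtain ⟨B, -, hB⟩ := exists_forall_norm_le hu
  obtain ⟨B', -, hB'⟩ := exists_forall_norm_le φ.continuous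
  have hint : Integrable (fun x => ‖φ x - meanEmbedding u (condDistr π x)‖ ^ 2)
      (π : Measure (K × K)).fst := by
    refine .of_bound ((φ.continuous.stronglyMeasurable.sub hsm).norm.pow 2).aestronglyMeasurable
      ((B' + B) ^ 2) (.of_forall fun x => ?_)
    simp only [norm_pow, norm_norm]
    gcongr
    exact (norm_sub_le _ _).trans (add_le_add (hB' x) (norm_meanEmbedding_le hB _))
  rw [← Measure.integral_condKernel (continuous_tangentCost hu γ
    φ.continuous).integrable_of_compactSpace, ← integral_const_mul, planCost]
  have h (x : K) := integral_tangentCost hu γ φ x (condDistr π x)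
  change (∫ x, ∫ y, tangentCost u γ φ (x, y) ∂(condDistr π x : Measure K) ∂_) + _ = _
  simp_rw [h]
  rw [integral_sub (integrable_kernelCost hu γ (measurable_condDistr π) _) (hint.const_mul _)]
  ring

theorem integral_tangentCost_le {u : K → H} (hu : Continuous u) {γ : ℝ} (hγ : 0 ≤ γ) (φ : C(K, H))
    (π : ProbabilityMeasure (K × K)) :
    ∫ p, tangentCost u γ φ p ∂(π : Measure (K × K))
      ≤ planCost (kernelCost (pdsKernel u) γ) π := by
  rw [← integral_tangentCost_add hu γ φ π, le_add_iff_nonneg_right]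
  exact mul_nonneg (by linarith) (integral_nonneg fun x => by positivity)

/-- The transport functional is the supremum of the integrals of the tangent costs, because the
conditional mean embeddings can be approximated in `L²` by continuous maps. -/
theorem exists_lt_integral_tangentCost {u : K → H} (hu : Continuous u) {γ : ℝ}
    (hγ : γ ∈ Icc (0 : ℝ) 1) {π : ProbabilityMeasure (K × K)} {t : ℝ}
    (ht : t < planCost (kernelCost (pdsKernel u) γ) π) :
    ∃ φ : C(K, H), t < ∫ p, tangentCost u γ φ p ∂(π : Measure (K × K)) := by
  obtain ⟨B, -, hB⟩ := exists_forall_norm_le hu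
  have hsm := stronglyMeasurable_meanEmbedding hu (measurable_condDistr π)
  have hL : MemLp (fun x => meanEmbedding u (condDistr π x)) (ENNReal.ofReal 2)
      (π : Measure (K × K)).fst :=
    .of_bound hsm.aestronglyMeasurable B (.of_forall fun x => norm_meanEmbedding_le hB _)
  obtain ⟨g, hg, -⟩ := hL.exists_boundedContinuous_integral_rpow_sub_le two_pos (sub_pos.2 ht)
  refine ⟨g.toContinuousMap, ?_⟩
  have h := integral_tangentCost_add hu γ g.toContinuousMap π
  simp only [Real.rpow_two] at hg
  simp_rw [norm_sub_rev (meanEmbedding u _)] at hg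
  have h2 := mul_le_mul_of_nonneg_left hg (div_nonneg hγ.1 two_pos.le)
  change _ + γ / 2 * (∫ x, ‖g x - _‖ ^ 2 ∂_) = _ at h
  nlinarith [hγ.1, hγ.2]

theorem lowerSemicontinuous_planCost {u : K → H} (hu : Continuous u) {γ : ℝ}
    (hγ : γ ∈ Icc (0 : ℝ) 1) :
    LowerSemicontinuous (planCost (kernelCost (pdsKernel u) γ)) := by
  intro π t ht
  obtain ⟨φ, hφ⟩ := exists_lt_integral_tangentCost hu hγ ht
  filter_upwards [(continuous_integral_of_compactSpace
    (continuous_tangentCost hu γ φ.continuous)).tendsto π |>.eventually_const_lt hφ] with π' h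
  exact h.trans_le (integral_tangentCost_le hu hγ.1 φ π')

theorem exists_isOTPlan {u : K → H} (hu : Continuous u) {γ : ℝ} (hγ : γ ∈ Icc (0 : ℝ) 1)
    (P Q : ProbabilityMeasure K) : ∃ π, IsOTPlan (kernelCost (pdsKernel u) γ) P Q π := by
  obtain ⟨π, hπ, hmin⟩ := ((lowerSemicontinuous_planCost hu hγ).lowerSemicontinuousOn
    _).exists_isMinOn (nonempty_plans P Q)
    ((isClosed_setOf_fst_eq P).inter (isClosed_setOf_snd_eq Q)).isCompact
  exact ⟨π, hπ, fun π' hπ' => hmin hπ'⟩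

end Plans

/-! ### The weak transform -/

section Transform

variable {K H : Type*} [MetricSpace K] [CompactSpace K] [MeasurableSpace K] [BorelSpace K]
  [NormedAddCommGroup H] [InnerProductSpace ℝ H] [CompleteSpace H]

theorem bddBelow_kernelCost_sub {u : K → H} (hu : Continuous u) (γ : ℝ) (f : C(K, ℝ)) (x : K) :
    BddBelow (range fun μ : ProbabilityMeasure K =>
      kernelCost (pdsKernel u) γ x μ - ∫ y, f y ∂(μ : Measure K)) := by
  obtain ⟨M, hM⟩ := exists_forall_abs_kernelCost_le hu γ
  obtain ⟨B, -, hB⟩ := exists_forall_norm_le f.continuous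
  refine ⟨-M - B, ?_⟩
  rintro _ ⟨μ, rfl⟩
  have h : |∫ y, f y ∂(μ : Measure K)| ≤ B := by
    simpa using norm_integral_le_of_norm_le_const (μ := (μ : Measure K)) (.of_forall hB)
  have := (abs_le.1 (hM x μ)).1
  have := (abs_le.1 h).2
  dsimp only
  linarith

theorem continuous_kernelCost_left {u : K → H} (hu : Continuous u) (γ : ℝ)
    (μ : ProbabilityMeasure K) : Continuous fun x => kernelCost (pdsKernel u) γ x μ := by
  simp only [kernelCost_eq hu]
  fun_prop

/-- The weak transform is continuous, because `x ↦ C(x, μ)` is continuous uniformly in `μ`. -/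
theorem continuous_cTransform {u : K → H} (hu : Continuous u) (γ : ℝ) (f : C(K, ℝ)) :
    Continuous (cTransform (kernelCost (pdsKernel u) γ) f) := by
  obtain ⟨B, -, hB⟩ := exists_forall_norm_le hu
  rcases isEmpty_or_nonempty K with hK | hK
  · exact continuous_of_const fun x => (hK.false x).elim
  have : Nonempty (ProbabilityMeasure K) := ⟨⟨Measure.dirac hK.some, inferInstance⟩⟩
  let d : K → K → ℝ := fun x x' => 1 / 2 * |‖u x‖ ^ 2 - ‖u x'‖ ^ 2| + ‖u x - u x'‖ * B
  have hd : ∀ x x', cTransform (kernelCost (pdsKernel u) γ) f x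
      ≤ cTransform (kernelCost (pdsKernel u) γ) f x' + d x x' := by
    intro x x'
    rw [← sub_le_iff_le_add]
    refine le_ciInf fun μ => ?_
    rw [sub_le_iff_le_add]
    refine (ciInf_le (bddBelow_kernelCost_sub hu γ f x) μ).trans ?_
    have h1 := le_abs_self (‖u x‖ ^ 2 - ‖u x'‖ ^ 2)
    have h2 : inner ℝ (u x') (meanEmbedding u μ) - inner ℝ (u x) (meanEmbedding u μ)
        ≤ ‖u x - u x'‖ * B := by
      rw [← inner_sub_left, norm_sub_rev]
      exact (real_inner_le_norm _ _).trans
        (mul_le_mul_of_nonneg_left (norm_meanEmbedding_le hB μ) (norm_nonneg _))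
    simp only [kernelCost_eq hu, d]
    linarith
  rw [continuous_iff_continuousAt]
  intro x₀
  have hlim : Tendsto (fun x => d x x₀) (𝓝 x₀) (𝓝 0) := by
    have hc : Continuous fun x => d x x₀ := by fun_prop
    simpa [d] using hc.tendsto x₀
  rw [ContinuousAt, tendsto_iff_norm_sub_tendsto_zero]
  refine squeeze_zero (fun _ => norm_nonneg _) (fun x => ?_) hlim
  rw [Real.norm_eq_abs, abs_sub_le_iff]
  have hsymm : d x₀ x = d x x₀ := by simp only [d, abs_sub_comm, norm_sub_rev]
  exact ⟨by linarith [hd x x₀], by linarith [hd x₀ x]⟩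

end Transform

/-! ### Stochastic maps and the inner infimum of the saddle-point functional -/

section Saddle

variable {K H : Type*} [MetricSpace K] [CompactSpace K] [MeasurableSpace K] [BorelSpace K]
  [NormedAddCommGroup H] [InnerProductSpace ℝ H] [CompleteSpace H]
  {Z : Type*} [MeasurableSpace Z]

theorem measurable_pushAt {X Y : Type*} [MeasurableSpace X] [MeasurableSpace Y]
    (S : ProbabilityMeasure Z) (T : StochMap X Z Y) :
    Measurable fun x => (pushAt S T x : Measure Y) := by
  refine Measure.measurable_of_measurable_coe _ fun s hs => ?_
  have h (x : X) : (pushAt S T x : Measure Y) s = (S : Measure Z) (Prod.mk x ⁻¹' (T.1 ⁻¹' s)) := by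
    exact Measure.map_apply (T.2.comp measurable_prodMk_left) hs
  simp_rw [h]
  exact measurable_measure_prodMk_left (T.2 hs)

theorem integral_pushAt {X Y : Type*} [MeasurableSpace X] [MeasurableSpace Y]
    (S : ProbabilityMeasure Z) (T : StochMap X Z Y) {f : Y → ℝ} (hf : StronglyMeasurable f)
    (x : X) : ∫ y, f y ∂(pushAt S T x : Measure Y) = ∫ z, f (T.1 (x, z)) ∂(S : Measure Z) :=
  integral_map (T.2.comp measurable_prodMk_left).aemeasurable hf.aestronglyMeasurable

theorem integrable_integral_comp_stochMap (S : ProbabilityMeasure Z) (f : C(K, ℝ))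
    (T : StochMap K Z K) (P : Measure K) [IsFiniteMeasure P] :
    Integrable (fun x => ∫ z, f (T.1 (x, z)) ∂(S : Measure Z)) P := by
  obtain ⟨B, -, hB⟩ := exists_forall_norm_le f.continuous
  have hm : StronglyMeasurable fun p => f (T.1 p) :=
    f.continuous.stronglyMeasurable.comp_measurable T.2
  refine .of_bound hm.integral_prod_right'.aestronglyMeasurable B (.of_forall fun x => ?_)
  simpa using norm_integral_le_of_norm_le_const (μ := (S : Measure Z))
    (.of_forall fun z => hB (T.1 (x, z)))

theorem integrable_saddleIntegrand {u : K → H} (hu : Continuous u) (γ : ℝ)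
    (S : ProbabilityMeasure Z) (f : C(K, ℝ)) (T : StochMap K Z K) (P : Measure K)
    [IsFiniteMeasure P] :
    Integrable (saddleIntegrand (kernelCost (pdsKernel u) γ) S f T) P :=
  (integrable_kernelCost hu γ (measurable_pushAt S T) P).sub
    (integrable_integral_comp_stochMap S f T P)

theorem dualValue_le_saddle {u : K → H} (hu : Continuous u) (γ : ℝ) (P Q : ProbabilityMeasure K)
    (S : ProbabilityMeasure Z) (f : C(K, ℝ)) (T : StochMap K Z K) :
    dualValue (kernelCost (pdsKernel u) γ) P Q f
      ≤ saddle (kernelCost (pdsKernel u) γ) P Q S f T := by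
  refine add_le_add_left (integral_mono (continuous_cTransform hu γ f).integrable_of_compactSpace
    (integrable_saddleIntegrand hu γ S f T _) fun x => ?_) _
  refine (ciInf_le (bddBelow_kernelCost_sub hu γ f x) (pushAt S T x)).trans_eq ?_
  rw [saddleIntegrand, integral_pushAt S T f.continuous.stronglyMeasurable]

variable [Nonempty K]

/-- Measurable selection of almost minimizers in the weak transform. By continuity in `x`, an almost
minimizer at `x` still works near `x`, so countably many distributions suffice, and each of them is
a push-forward of the atomless `S`. -/
theorem exists_stochMap_saddleIntegrand_lt [StandardBorelSpace Z] {u : K → H} (hu : Continuous u)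
    (γ : ℝ) (S : ProbabilityMeasure Z) [NullSingletonClass (S : Measure Z)] (f : C(K, ℝ))
    {ε : ℝ} (hε : 0 < ε) :
    ∃ T : StochMap K Z K, ∀ x, saddleIntegrand (kernelCost (pdsKernel u) γ) S f T x
      < cTransform (kernelCost (pdsKernel u) γ) f x + ε := by
  classical
  have : Nonempty (ProbabilityMeasure K) :=
    ⟨⟨Measure.dirac (Classical.arbitrary K), inferInstance⟩⟩
  set C := kernelCost (pdsKernel u) γ
  have hex (x : K) : ∃ μ : ProbabilityMeasure K,
      C x μ - ∫ y, f y ∂(μ : Measure K) < cTransform C f x + ε :=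
    exists_lt_of_ciInf_lt (lt_add_of_pos_right _ hε)
  choose μ hμ using hex
  let U : K → Set K := fun x₀ =>
    {x | C x (μ x₀) - ∫ y, f y ∂(μ x₀ : Measure K) < cTransform C f x + ε}
  have hU (x₀ : K) : IsOpen (U x₀) :=
    isOpen_lt ((continuous_kernelCost_left hu γ _).sub continuous_const)
      ((continuous_cTransform hu γ f).add continuous_const)
  obtain ⟨s, hs, hcov⟩ := TopologicalSpace.countable_cover_nhds
    fun x => (hU x).mem_nhds (hμ x)
  have hne : s.Nonempty := by
    by_contra! h
    simp [h, eq_comm (a := (∅ : Set K))] at hcov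
  obtain ⟨c, rfl⟩ := hs.exists_eq_range hne
  have hN (x : K) : ∃ n, x ∈ U (c n) := by
    have := hcov ▸ mem_univ x
    simpa using this
  choose g hg hgmap using fun n =>
    exists_measurable_map_eq_of_atomless (S : Measure Z) (μ (c n) : Measure K)
  have hmeas : Measurable fun p : ℕ × Z => g p.1 p.2 :=
    measurable_from_prod_countable_right fun n => hg n
  have hfind : Measurable fun x => Nat.find (hN x) :=
    measurable_find hN fun n => (hU (c n)).measurableSet
  let T : StochMap K Z K := ⟨fun p => g (Nat.find (hN p.1)) p.2,
    hmeas.comp ((hfind.comp measurable_fst).prodMk measurable_snd)⟩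
  refine ⟨T, fun x => ?_⟩
  have hT : pushAt S T x = μ (c (Nat.find (hN x))) := Subtype.ext (hgmap (Nat.find (hN x)))
  rw [saddleIntegrand, ← integral_pushAt S T f.continuous.stronglyMeasurable, hT]
  exact Nat.find_spec (hN x)

theorem iInf_saddle_eq_dualValue [StandardBorelSpace Z] {u : K → H} (hu : Continuous u) (γ : ℝ)
    (P Q : ProbabilityMeasure K) (S : ProbabilityMeasure Z) [NullSingletonClass (S : Measure Z)]
    (f : C(K, ℝ)) :
    ⨅ T : StochMap K Z K, saddle (kernelCost (pdsKernel u) γ) P Q S f T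
      = dualValue (kernelCost (pdsKernel u) γ) P Q f := by
  have : Nonempty (StochMap K Z K) := ⟨⟨fun _ => Classical.arbitrary K, measurable_const⟩⟩
  refine ciInf_eq_of_forall_ge_of_forall_gt_exists_lt
    (fun T => dualValue_le_saddle hu γ P Q S f T) fun w hw => ?_
  obtain ⟨T, hT⟩ := exists_stochMap_saddleIntegrand_lt hu γ S f (half_pos (sub_pos.2 hw))
  refine ⟨T, ?_⟩
  have hint : Integrable (cTransform (kernelCost (pdsKernel u) γ) f) (P : Measure K) :=
    (continuous_cTransform hu γ f).integrable_of_compactSpace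
  have h := integral_mono (integrable_saddleIntegrand hu γ S f T (P : Measure K))
    (hint.add (integrable_const _)) fun x => (hT x).le
  simp only [Pi.add_apply] at h
  rw [integral_add hint (integrable_const _)] at h
  simp only [integral_const, probReal_univ, one_smul] at h
  rw [saddle]
  rw [dualValue] at h hw
  linarith

/-- The transport plan `∫ δ_x ⊗ T_x♯S dP(x)` of a stochastic map, which is the law of
`(x, T(x, z))` under `P ⊗ S`. -/
def planOf {X Y : Type*} [MeasurableSpace X] [MeasurableSpace Y] (P : ProbabilityMeasure X)
    (S : ProbabilityMeasure Z) (T : StochMap X Z Y) : ProbabilityMeasure (X × Y) :=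
  (P.prod S).map (f := fun p => (p.1, T.1 p)) (measurable_fst.prodMk T.2).aemeasurable

theorem toMeasure_planOf {X Y : Type*} [MeasurableSpace X] [MeasurableSpace Y]
    (P : ProbabilityMeasure X) (S : ProbabilityMeasure Z) (T : StochMap X Z Y) :
    (planOf P S T : Measure (X × Y))
      = ((P : Measure X).prod (S : Measure Z)).map fun p => (p.1, T.1 p) := rfl

theorem fst_planOf {X Y : Type*} [MeasurableSpace X] [MeasurableSpace Y]
    (P : ProbabilityMeasure X) (S : ProbabilityMeasure Z) (T : StochMap X Z Y) :
    (planOf P S T : Measure (X × Y)).fst = (P : Measure X) := by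
  rw [toMeasure_planOf, Measure.fst_map_prodMk T.2]
  exact Measure.fst_prod

theorem condDistr_planOf {X Y : Type*} [MeasurableSpace X] [MeasurableSpace Y]
    [StandardBorelSpace Y] [Nonempty Y] (P : ProbabilityMeasure X) (S : ProbabilityMeasure Z)
    (T : StochMap X Z Y) :
    condDistr (planOf P S T) =ᵐ[(P : Measure X)] pushAt S T := by
  let κ : Kernel X Y := ⟨fun x => (pushAt S T x : Measure Y), measurable_pushAt S T⟩
  have : IsMarkovKernel κ := ⟨fun x => (pushAt S T x).2⟩
  have h : (planOf P S T : Measure (X × Y)) = (planOf P S T : Measure (X × Y)).fst ⊗ₘ κ := by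
    rw [fst_planOf]
    ext s hs
    have hT : Measurable fun p : X × Z => (p.1, T.1 p) := measurable_fst.prodMk T.2
    rw [Measure.compProd_apply hs, toMeasure_planOf, Measure.map_apply hT hs,
      Measure.prod_apply (hT hs)]
    refine lintegral_congr fun x => ?_
    exact (Measure.map_apply (T.2.comp measurable_prodMk_left) (measurable_prodMk_left hs)).symm
  have := eq_condKernel_of_measure_eq_compProd κ h
  rw [fst_planOf] at this
  filter_upwards [this] with x hx
  exact Subtype.ext hx.symm

/-- The saddle-point functional at `T` is the relaxed primal functional at the plan of `T`, because
the conditional distributions of that plan are almost surely `T_x♯S`. -/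
theorem saddle_eq_planCost {u : K → H} (hu : Continuous u) (γ : ℝ) (P Q : ProbabilityMeasure K)
    (S : ProbabilityMeasure Z) (f : C(K, ℝ)) (T : StochMap K Z K) :
    saddle (kernelCost (pdsKernel u) γ) P Q S f T
      = planCost (kernelCost (pdsKernel u) γ) (planOf P S T)
        - ∫ p, f p.2 ∂(planOf P S T : Measure (K × K)) + ∫ y, f y ∂(Q : Measure K) := by
  have h1 : planCost (kernelCost (pdsKernel u) γ) (planOf P S T)
      = ∫ x, kernelCost (pdsKernel u) γ x (pushAt S T x) ∂(P : Measure K) := by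
    rw [planCost, fst_planOf]
    refine integral_congr_ae ?_
    filter_upwards [condDistr_planOf P S T] with x hx
    rw [hx]
  have hT : Measurable fun p : K × Z => (p.1, T.1 p) := measurable_fst.prodMk T.2
  have hf : StronglyMeasurable fun p : K × Z => f (T.1 p) :=
    f.continuous.stronglyMeasurable.comp_measurable T.2
  obtain ⟨B, -, hB⟩ := exists_forall_norm_le f.continuous
  have h2 : ∫ p, f p.2 ∂(planOf P S T : Measure (K × K))
      = ∫ x, ∫ z, f (T.1 (x, z)) ∂(S : Measure Z) ∂(P : Measure K) := by
    rw [toMeasure_planOf, integral_map hT.aemeasurable (f := fun p : K × K => f p.2)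
      (f.continuous.comp continuous_snd).stronglyMeasurable.aestronglyMeasurable]
    exact integral_prod _ (.of_bound hf.aestronglyMeasurable B (.of_forall fun p => hB _))
  rw [h1, h2, ← integral_sub (integrable_kernelCost hu γ (measurable_pushAt S T) _)
    (integrable_integral_comp_stochMap S f T _)]
  rfl

end Saddle

/-! ### Duality -/

/-- The convex combination of two distributions. -/
def mix {X : Type*} [MeasurableSpace X] (μ ν : ProbabilityMeasure X) {a b : ℝ} (ha : 0 ≤ a)
    (hb : 0 ≤ b) (hab : a + b = 1) : ProbabilityMeasure X :=
  ⟨ENNReal.ofReal a • (μ : Measure X) + ENNReal.ofReal b • (ν : Measure X), ⟨by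
    simp [← ENNReal.ofReal_add ha hb, hab]⟩⟩

theorem integral_mix {X : Type*} [MeasurableSpace X] (μ ν : ProbabilityMeasure X) {a b : ℝ}
    (ha : 0 ≤ a) (hb : 0 ≤ b) (hab : a + b = 1) {f : X → ℝ} (hμ : Integrable f (μ : Measure X))
    (hν : Integrable f (ν : Measure X)) :
    ∫ x, f x ∂(mix μ ν ha hb hab : Measure X)
      = a * ∫ x, f x ∂(μ : Measure X) + b * ∫ x, f x ∂(ν : Measure X) := by
  change ∫ x, f x ∂(ENNReal.ofReal a • (μ : Measure X) + ENNReal.ofReal b • (ν : Measure X)) = _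
  rw [integral_add_measure (hμ.smul_measure ENNReal.ofReal_ne_top)
    (hν.smul_measure ENNReal.ofReal_ne_top), integral_smul_measure, integral_smul_measure,
    ENNReal.toReal_ofReal ha, ENNReal.toReal_ofReal hb, smul_eq_mul, smul_eq_mul]

theorem fst_mix {X Y : Type*} [MeasurableSpace X] [MeasurableSpace Y] {P : Measure X}
    {μ ν : ProbabilityMeasure (X × Y)} {a b : ℝ} (ha : 0 ≤ a)
    (hb : 0 ≤ b) (hab : a + b = 1) (hμ : (μ : Measure (X × Y)).fst = P)
    (hν : (ν : Measure (X × Y)).fst = P) : (mix μ ν ha hb hab : Measure (X × Y)).fst = P := by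
  change (ENNReal.ofReal a • (μ : Measure (X × Y)) + ENNReal.ofReal b • (ν : Measure (X × Y))).fst
    = P
  rw [Measure.fst, Measure.map_add _ _ measurable_fst, Measure.map_smul, Measure.map_smul]
  change ENNReal.ofReal a • (μ : Measure (X × Y)).fst + ENNReal.ofReal b •
    (ν : Measure (X × Y)).fst = P
  rw [hμ, hν, ← add_smul, ← ENNReal.ofReal_add ha hb, hab, ENNReal.ofReal_one, one_smul]

theorem continuous_lagrangian_integrand {K H : Type*} [TopologicalSpace K]
    [NormedAddCommGroup H] [InnerProductSpace ℝ H] {u : K → H} (hu : Continuous u) (γ : ℝ)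
    (v : C(K, H) × C(K, ℝ)) : Continuous fun p : K × K => tangentCost u γ v.1 p - v.2 p.2 :=
  (continuous_tangentCost hu γ v.1.continuous).sub (v.2.continuous.comp continuous_snd)

section Duality

variable {K H : Type*} [MetricSpace K] [CompactSpace K] [MeasurableSpace K] [BorelSpace K]
  [NormedAddCommGroup H] [InnerProductSpace ℝ H]

/-- The Lagrangian `∫ c_φ dπ - ∫ f dπ₂ + ∫ f dQ`, in which the cost is linearized by `φ` and the
second marginal constraint is relaxed with multiplier `f`. -/
def lagrangian (u : K → H) (γ : ℝ) (Q : ProbabilityMeasure K) (π : ProbabilityMeasure (K × K))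
    (v : C(K, H) × C(K, ℝ)) : ℝ :=
  ∫ p, (tangentCost u γ v.1 p - v.2 p.2) ∂(π : Measure (K × K)) + ∫ y, v.2 y ∂(Q : Measure K)

theorem lagrangian_eq {u : K → H} (hu : Continuous u) (γ : ℝ) (Q : ProbabilityMeasure K)
    (π : ProbabilityMeasure (K × K)) (v : C(K, H) × C(K, ℝ)) :
    lagrangian u γ Q π v = ∫ p, tangentCost u γ v.1 p ∂(π : Measure (K × K))
      - ∫ p, v.2 p.2 ∂(π : Measure (K × K)) + ∫ y, v.2 y ∂(Q : Measure K) := by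
  have hf : Integrable (fun p : K × K => v.2 p.2) (π : Measure (K × K)) :=
    (v.2.continuous.comp continuous_snd).integrable_of_compactSpace
  rw [lagrangian, integral_sub
    (continuous_tangentCost hu γ v.1.continuous).integrable_of_compactSpace hf]

theorem concaveOn_lagrangian {u : K → H} (hu : Continuous u) {γ : ℝ} (hγ : 0 ≤ γ)
    (Q : ProbabilityMeasure K) (π : ProbabilityMeasure (K × K)) :
    ConcaveOn ℝ univ (lagrangian u γ Q π) := by
  refine ⟨convex_univ, fun v _ w _ a b ha hb hab => ?_⟩
  have hi (v : C(K, H) × C(K, ℝ)) : Integrable (fun p : K × K => tangentCost u γ v.1 p - v.2 p.2)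
      (π : Measure (K × K)) := (continuous_lagrangian_integrand hu γ v).integrable_of_compactSpace
  have hQ (f : C(K, ℝ)) : Integrable f (Q : Measure K) := f.continuous.integrable_of_compactSpace
  have h1 : a * ∫ p, (tangentCost u γ v.1 p - v.2 p.2) ∂(π : Measure (K × K))
      + b * ∫ p, (tangentCost u γ w.1 p - w.2 p.2) ∂(π : Measure (K × K))
      ≤ ∫ p, (tangentCost u γ (a • v + b • w).1 p - (a • v + b • w).2 p.2)
        ∂(π : Measure (K × K)) := by
    rw [← integral_const_mul, ← integral_const_mul,
      ← integral_add ((hi v).const_mul a) ((hi w).const_mul b)]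
    refine integral_mono (((hi v).const_mul a).add ((hi w).const_mul b)) (hi _) fun p => ?_
    have h := (concaveOn_tangentCost u hγ p).2 (mem_univ v.1) (mem_univ w.1) ha hb hab
    simp only [smul_eq_mul] at h
    simp only [Prod.fst_add, Prod.smul_fst, Prod.snd_add, Prod.smul_snd,
      ContinuousMap.add_apply (f := a • v.2), ContinuousMap.smul_apply, smul_eq_mul]
    linarith
  have h2 : ∫ y, (a • v + b • w).2 y ∂(Q : Measure K)
      = a * ∫ y, v.2 y ∂(Q : Measure K) + b * ∫ y, w.2 y ∂(Q : Measure K) := by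
    rw [← integral_const_mul, ← integral_const_mul,
      ← integral_add ((hQ _).const_mul a) ((hQ _).const_mul b)]
    rfl
  simp only [lagrangian, smul_eq_mul] at h1 h2 ⊢
  rw [h2]
  linarith

variable [Nonempty K] [CompleteSpace H]

theorem bddBelow_planCost {u : K → H} (hu : Continuous u) {γ : ℝ} (hγ : γ ∈ Icc (0 : ℝ) 1)
    {P Q : ProbabilityMeasure K} :
    BddBelow (planCost (kernelCost (pdsKernel u) γ) '' plans P Q) := by
  obtain ⟨π, -, hmin⟩ := exists_isOTPlan hu hγ P Q
  exact ⟨_, by rintro _ ⟨π', hπ', rfl⟩; exact hmin π' hπ'⟩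

theorem dualValue_le_otCost {u : K → H} (hu : Continuous u) (γ : ℝ)
    (P Q : ProbabilityMeasure K) (f : C(K, ℝ)) :
    dualValue (kernelCost (pdsKernel u) γ) P Q f ≤ otCost (kernelCost (pdsKernel u) γ) P Q := by
  refine le_csInf ((nonempty_plans P Q).image _) ?_
  rintro _ ⟨π, ⟨hP, hQ⟩, rfl⟩
  have hf : Integrable (fun p : K × K => f p.2) (π : Measure (K × K)) :=
    (f.continuous.comp continuous_snd).integrable_of_compactSpace
  have h1 : ∫ y, f y ∂(Q : Measure K)
      = ∫ x, ∫ y, f y ∂(condDistr π x : Measure K) ∂(P : Measure K) := by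
    rw [← hQ, ← hP]
    refine Eq.trans ?_ (Measure.integral_condKernel hf).symm
    exact integral_map measurable_snd.aemeasurable
      f.continuous.stronglyMeasurable.aestronglyMeasurable
  have hint : Integrable (fun x => ∫ y, f y ∂(condDistr π x : Measure K)) (P : Measure K) := by
    rw [← hP]
    exact hf.integral_condKernel
  rw [planCost, hP, dualValue, h1, ← integral_add
    (continuous_cTransform hu γ f).integrable_of_compactSpace hint]
  refine integral_mono ((continuous_cTransform hu γ f).integrable_of_compactSpace.add hint)
    (integrable_kernelCost hu γ (measurable_condDistr π) _) fun x => ?_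
  exact le_sub_iff_add_le.1 (ciInf_le (bddBelow_kernelCost_sub hu γ f x) (condDistr π x))

/-- A plan violating the second marginal constraint makes the Lagrangian arbitrarily large through
the multiplier, and any other plan through the linearization of its cost. -/
theorem exists_lt_lagrangian {u : K → H} (hu : Continuous u) {γ : ℝ} (hγ : γ ∈ Icc (0 : ℝ) 1)
    {P Q : ProbabilityMeasure K} {t : ℝ} (ht : t < otCost (kernelCost (pdsKernel u) γ) P Q)
    {π : ProbabilityMeasure (K × K)} (hπ : (π : Measure (K × K)).fst = (P : Measure K)) :
    ∃ v, t < lagrangian u γ Q π v := by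
  simp only [lagrangian_eq hu]
  by_cases hQ : (π : Measure (K × K)).snd = (Q : Measure K)
  · have hle := csInf_le (bddBelow_planCost hu hγ) (mem_image_of_mem _ (⟨hπ, hQ⟩ : π ∈ plans P Q))
    obtain ⟨φ, hφ⟩ := exists_lt_integral_tangentCost hu hγ (ht.trans_le hle)
    exact ⟨(φ, 0), by simpa using hφ⟩
  · obtain ⟨f, hf⟩ : ∃ f : BoundedContinuousFunction K ℝ,
        ∫ y, f y ∂(π : Measure (K × K)).snd ≠ ∫ y, f y ∂(Q : Measure K) := by
      by_contra! h
      exact hQ (ext_of_forall_integral_eq_of_IsFiniteMeasure h)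
    have hsnd : ∫ y, f y ∂(π : Measure (K × K)).snd = ∫ p, f p.2 ∂(π : Measure (K × K)) :=
      integral_map measurable_snd.aemeasurable f.continuous.stronglyMeasurable.aestronglyMeasurable
    rw [hsnd] at hf
    -- the multiple of `f` is chosen to give the Lagrangian the value `t + 1`
    set A := ∫ p, tangentCost u γ (0 : C(K, H)) p ∂(π : Measure (K × K)) with hA
    set δ := ∫ y, f y ∂(Q : Measure K) - ∫ p, f p.2 ∂(π : Measure (K × K)) with hδ
    have hδ0 : δ ≠ 0 := sub_ne_zero.2 hf.symm
    refine ⟨(0, ((t - A + 1) / δ) • f.toContinuousMap), ?_⟩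
    have h1 : (t - A + 1) / δ * δ = t - A + 1 := div_mul_cancel₀ _ hδ0
    have h2 : ∀ y, ((((t - A + 1) / δ) • f.toContinuousMap : C(K, ℝ)) : K → ℝ) y
        = (t - A + 1) / δ * f y := fun _ => rfl
    simp only [h2, integral_const_mul]
    rw [← hA]
    rw [hδ, mul_sub] at h1
    linarith

/-- Absence of a duality gap: the minimax principle on the compact set of plans with first marginal
`P` provides one multiplier `f` for all plans, in particular for those of stochastic maps. -/
theorem exists_le_dualValue {Z : Type*} [MeasurableSpace Z]
    [StandardBorelSpace Z] (S : ProbabilityMeasure Z) [NullSingletonClass (S : Measure Z)]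
    {u : K → H} (hu : Continuous u) {γ : ℝ} (hγ : γ ∈ Icc (0 : ℝ) 1) {P Q : ProbabilityMeasure K}
    {t : ℝ} (ht : t < otCost (kernelCost (pdsKernel u) γ) P Q) :
    ∃ f : C(K, ℝ), t ≤ dualValue (kernelCost (pdsKernel u) γ) P Q f := by
  let X := {π : ProbabilityMeasure (K × K) // (π : Measure (K × K)).fst = (P : Measure K)}
  have : CompactSpace X := isCompact_iff_compactSpace.1 (isClosed_setOf_fst_eq P).isCompact
  obtain ⟨v, hv⟩ : ∃ v, ∀ π : X, t < lagrangian u γ Q π.1 v := by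
    refine exists_forall_lt_of_concave (fun v => ?_)
      (fun π : X => concaveOn_lagrangian hu hγ.1 Q π.1) ?_
      fun π => exists_lt_lagrangian hu hγ ht π.2
    · exact ((continuous_integral_of_compactSpace
        (continuous_lagrangian_integrand hu γ v)).comp continuous_subtype_val).add continuous_const
    · intro π π' a b ha hb hab
      refine ⟨⟨mix π.1 π'.1 ha hb hab, fst_mix ha hb hab π.2 π'.2⟩, fun v => ?_⟩
      have hi := continuous_lagrangian_integrand hu γ v
      simp only [lagrangian]
      rw [integral_mix _ _ ha hb hab hi.integrable_of_compactSpace hi.integrable_of_compactSpace]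
      linear_combination -(∫ y, v.2 y ∂(Q : Measure K)) * hab
  refine ⟨v.2, ?_⟩
  have : Nonempty (StochMap K Z K) := ⟨⟨fun _ => Classical.arbitrary K, measurable_const⟩⟩
  rw [← iInf_saddle_eq_dualValue hu γ P Q S]
  refine le_ciInf fun T => ?_
  have h := hv ⟨planOf P S T, fst_planOf P S T⟩
  rw [lagrangian_eq hu] at h
  rw [saddle_eq_planCost hu]
  linarith [integral_tangentCost_le hu hγ.1 v.1 (planOf P S T)]

end Duality

end WeakOT

end

theorem corollary2 {D : ℕ} (K : Set (EuclideanSpace ℝ (Fin D))) [CompactSpace K] [Nonempty K]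
    {H : Type*} [NormedAddCommGroup H] [InnerProductSpace ℝ H] [CompleteSpace H]
    (u : K → H) (hk : Continuous fun p : K × K => WeakOT.pdsKernel u p.1 p.2)
    (γ : ℝ) (hγ : γ ∈ Set.Icc (0 : ℝ) 1)
    (P Q : ProbabilityMeasure K)
    {Z : Type*} [TopologicalSpace Z] [PolishSpace Z] [MeasurableSpace Z] [BorelSpace Z]
    (S : ProbabilityMeasure Z) (hS : ∀ z, (S : Measure Z) {z} = 0)
    (C : K → ProbabilityMeasure K → ℝ) (hC : C = WeakOT.kernelCost (WeakOT.pdsKernel u) γ) :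
    -- an optimal plan exists (all the integrals and the infimum in the primal problem make sense)
    ((∀ π ∈ WeakOT.plans P Q,
        Integrable (fun x => C x (WeakOT.condDistr π x)) (P : Measure K)) ∧
      BddBelow (WeakOT.planCost C '' WeakOT.plans P Q) ∧
      ∃ π, WeakOT.IsOTPlan C P Q π) ∧
    -- duality through the weak `C`-transform (which is finite and integrable)
    ((∀ f : C(K, ℝ), (∀ x, BddBelow (Set.range fun μ : ProbabilityMeasure K =>
          C x μ - ∫ y, f y ∂(μ : Measure K))) ∧
        Integrable (WeakOT.cTransform C f) (P : Measure K)) ∧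
      IsLUB (Set.range fun f : C(K, ℝ) => WeakOT.dualValue C P Q f) (WeakOT.otCost C P Q)) ∧
    -- the saddle-point form (whose integrals and inner infima make sense)
    ((∀ f : C(K, ℝ), (∀ T : WeakOT.StochMap K Z K,
          Integrable (WeakOT.saddleIntegrand C S f T) (P : Measure K)) ∧
        BddBelow (Set.range fun T : WeakOT.StochMap K Z K => WeakOT.saddle C P Q S f T)) ∧
      IsLUB (Set.range fun f : C(K, ℝ) =>
          ⨅ T : WeakOT.StochMap K Z K, WeakOT.saddle C P Q S f T)
        (WeakOT.otCost C P Q)) := by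
  subst hC
  have hu : Continuous u := WeakOT.continuous_of_continuous_pdsKernel hk
  have : NullSingletonClass (S : Measure Z) := ⟨hS⟩
  have hopt := WeakOT.exists_isOTPlan hu hγ P Q
  have hlub : IsLUB (Set.range fun f : C(K, ℝ) =>
      WeakOT.dualValue (WeakOT.kernelCost (WeakOT.pdsKernel u) γ) P Q f)
      (WeakOT.otCost (WeakOT.kernelCost (WeakOT.pdsKernel u) γ) P Q) := by
    refine ⟨?_, fun b hb => le_of_forall_lt fun t ht => ?_⟩
    · rintro _ ⟨f, rfl⟩
      exact WeakOT.dualValue_le_otCost hu γ P Q f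
    · obtain ⟨t', htt', ht'⟩ := exists_between ht
      obtain ⟨f, hf⟩ := WeakOT.exists_le_dualValue S hu hγ ht'
      exact htt'.trans_le (hf.trans (hb ⟨f, rfl⟩))
  refine ⟨⟨fun π _ => WeakOT.integrable_kernelCost hu γ (WeakOT.measurable_condDistr π) _,
    WeakOT.bddBelow_planCost hu hγ, hopt⟩,
    ⟨fun f => ⟨WeakOT.bddBelow_kernelCost_sub hu γ f,
      (WeakOT.continuous_cTransform hu γ f).integrable_of_compactSpace⟩, hlub⟩,
    fun f => ⟨fun T => WeakOT.integrable_saddleIntegrand hu γ S f T _, ?_⟩, ?_⟩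
  · exact ⟨_, by rintro _ ⟨T, rfl⟩; exact WeakOT.dualValue_le_saddle hu γ P Q S f T⟩
  · simpa only [WeakOT.iInf_saddle_eq_dualValue hu γ P Q S] using hlub
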